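/- Let $\Sigma=\{-1,1\}^{\mathbb Z}$ with the product topology and the shift $\sigma((s_k)_k)=(s_{k+1})_k$. Let $\beta_1,\beta_2\in(0,1)$ with $\beta_1+\beta_2\ge 1$. For $s=(s_k)_{k\in\mathbb Z}\in\Sigma$ and $k\ge 0$ let $\sharp_k(s)$ be the number of $i\in\{0,\dots,k\}$ with $s_i=-1$, and put $$\pi^*_{\beta_1,\beta_2}(s)=\sum_{k=0}^{\infty}s_k\,\beta_2^{\sharp_k(s)}\beta_1^{k-\sharp_k(s)+1},\qquad \varsigma(s)=\sum_{k=1}^{\infty}s_{-k}2^{-k}.$$ Let $L_{\beta_1,\beta_2}$ be the affine map of the line with $L_{\beta_1,\beta_2}\big(\tfrac{-\beta_2}{1-\beta_2}\big)=-1$ and $L_{\beta_1,\beta_2}\big(\tfrac{\beta_1}{1-\beta_1}\big)=1$, and let $$\bar\pi_{\beta_1,\beta_2}:\Sigma\to[-1,1]^2,\qquad \bar\pi_{\beta_1,\beta_2}(s)=\big(L_{\beta_1,\beta_2}(\pi^*_{\beta_1,\beta_2}(s)),\,\varsigma(s)\big).$$ For a Borel probability measure $\nu$ on $[-1,1]^2$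 let $\dim_H\nu=\inf\{\dim_H B : B \text{ Borel},\ \nu(B)=1\}$. **Proposition 5.1.** For every $\sigma$-ergodic ($\sigma$-invariant) Borel probability measure $\mu$ on $\Sigma$ and all $\beta_1,\beta_2\in(0,1)$ with $\beta_1+\beta_2\ge1$, the measure $\bar\mu_{\beta_1,\beta_2}=\mu\circ\bar\pi_{\beta_1,\beta_2}^{-1}$ satisfies $$\dim_H\bar\mu_{\beta_1,\beta_2}\le\frac{h(\mu)}{\log 2}+1,$$ where $h(\mu)$ is the metric (Kolmogorov–Sinai) entropy of $\sigma$ with respect to $\mu$, computed with the natural logarithm. -/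

import Mathlib

open MeasureTheory Filter
open scoped ENNReal

namespace Baker

noncomputable section

/-! ### Dimension of a measure and measure-theoretic entropy -/

/-- The Hausdorff dimension of a Borel probability measure `ν`:
the infimum of the Hausdorff dimensions of the measurable sets of full measure. -/
def dimHMeasure {X : Type*} [EMetricSpace X] [MeasurableSpace X] (ν : Measure X) : ℝ≥0∞ :=
  ⨅ (B : Set X) (_ : MeasurableSet B) (_ : ν B = 1), dimH B

/-- The Shannon entropy (natural logarithm) `-∑ i, μ (P i) log μ (P i)` of the finite partition
into the sets `{x | P x = i}`. -/
def partitionEntropy {X : Type*} [MeasurableSpace X] {ι : Type*} [Fintype ι]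
    (μ : Measure X) (P : X → ι) : ℝ :=
  ∑ i : ι, Real.negMulLog (μ.real (P ⁻¹' {i}))

/-- The labelling map of the join of the partitions `P, T⁻¹ P, …, T⁻⁽ⁿ⁻¹⁾ P`. -/
def itinerary {X : Type*} {ι : Type*} (T : X → X) (P : X → ι) (n : ℕ) : X → (Fin n → ι) :=
  fun x i => P (T^[(i : ℕ)] x)

/-- The entropy of `T` with respect to the partition given by `P`: the limit of the normalised
entropies of the iterated joins. For invariant probability measures the limit exists,
so that the `limsup` is this limit. -/
def entropyOfPartition {X : Type*} [MeasurableSpace X] {ι : Type*} [Fintype ι]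
    (T : X → X) (μ : Measure X) (P : X → ι) : ℝ≥0∞ :=
  limsup (fun n : ℕ => ENNReal.ofReal (partitionEntropy μ (itinerary T P n) / n)) atTop

/-- The metric (Kolmogorov–Sinai) entropy of `T` with respect to `μ`: the supremum of the
entropies with respect to all finite measurable partitions. A finite measurable partition is
given by its measurable labelling map to some `Fin k`. -/
def metricEntropy {X : Type*} [MeasurableSpace X] (T : X → X) (μ : Measure X) : ℝ≥0∞ :=
  ⨆ (k : ℕ) (P : X → Fin k) (_ : Measurable P), entropyOfPartition T μ P

/-! ### The shift spaces and the coding map -/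

/-- The alphabet `{-1, 1}`. -/
abbrev Alphabet : Type := ({-1, 1} : Set ℤ)

/-- The two-sided sequence space `{-1, 1}^ℤ`, with the product topology and the product
sigma-algebra (which is its Borel sigma-algebra). -/
abbrev FullShift : Type := ℤ → Alphabet

/-- The one-sided sequence space `{-1, 1}^ℕ`. -/
abbrev OneSidedShift : Type := ℕ → Alphabet

/-- The forward shift `(s_k) ↦ (s_{k+1})` on the two-sided sequence space. -/
def shift (s : FullShift) : FullShift := fun k => s (k + 1)

/-- The number of indices `i ∈ {0, …, k}` with `s_i = -1`. -/
def negCount (s : OneSidedShift) (k : ℕ) : ℕ :=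
  ((Finset.range (k + 1)).filter fun i => (s i : ℤ) = -1).card

/-- `π*(s) = ∑_{k ≥ 0} s_k β₂^{♯_k(s)} β₁^{k - ♯_k(s) + 1}`. Since `♯_k(s) ≤ k + 1`,
the subtraction in the exponent is never truncated. -/
def piStar (β₁ β₂ : ℝ) (s : OneSidedShift) : ℝ :=
  ∑' k : ℕ, ((s k : ℤ) : ℝ) * β₂ ^ negCount s k * β₁ ^ (k + 1 - negCount s k)

/-- The affine map of the line that sends `-β₂ / (1 - β₂)` to `-1` and `β₁ / (1 - β₁)` to `1`. -/
def affineScale (β₁ β₂ : ℝ) (x : ℝ) : ℝ :=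
  -1 + 2 * (x - (-β₂ / (1 - β₂))) / (β₁ / (1 - β₁) - (-β₂ / (1 - β₂)))

/-- The first coordinate map of the coding, `L ∘ π*`, onto `[-1, 1]`. -/
def piScaled (β₁ β₂ : ℝ) (s : OneSidedShift) : ℝ :=
  affineScale β₁ β₂ (piStar β₁ β₂ s)

/-- The signed dyadic expansion `∑_{k ≥ 1} s_{-k} 2^{-k}`; it depends on the negative
coordinates of `s` only. -/
def dyadicCoding (s : FullShift) : ℝ :=
  ∑' k : ℕ, ((s (-((k : ℤ) + 1)) : ℤ) : ℝ) * (1 / 2 : ℝ) ^ (k + 1)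

/-- The coding map from the two-sided shift space to the square `[-1, 1]²`, regarded as a subset
of the plane. The maximum metric of `ℝ × ℝ` is bi-Lipschitz equivalent to the Euclidean one,
so that Hausdorff dimensions are the usual ones. -/
def codingMap (β₁ β₂ : ℝ) (s : FullShift) : ℝ × ℝ :=
  (piScaled β₁ β₂ (fun k : ℕ => s (k : ℤ)), dyadicCoding s)

lemma abs_alphabet (a : Alphabet) : |((a : ℤ) : ℝ)| = 1 := by
  rcases a with ⟨a, rfl | rfl⟩ <;> simp

lemma negCount_le (s : OneSidedShift) (k : ℕ) : negCount s k ≤ k + 1 := by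
  simpa [negCount] using Finset.card_filter_le (Finset.range (k + 1)) fun i => (s i : ℤ) = -1

lemma summable_piStar {β₁ β₂ : ℝ} (h1 : β₁ ∈ Set.Ioo (0 : ℝ) 1) (h2 : β₂ ∈ Set.Ioo (0 : ℝ) 1)
    (s : OneSidedShift) :
    Summable fun k : ℕ =>
      ((s k : ℤ) : ℝ) * β₂ ^ negCount s k * β₁ ^ (k + 1 - negCount s k) := by
  have hm : 0 < max β₁ β₂ := lt_max_of_lt_left h1.1
  refine Summable.of_norm_bounded (g := fun k : ℕ => max β₁ β₂ ^ (k + 1)) ?_ fun k => ?_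
  · exact (summable_nat_add_iff 1).2
      (summable_geometric_of_lt_one hm.le (max_lt h1.2 h2.2))
  · rw [norm_mul, norm_mul, Real.norm_eq_abs, abs_alphabet, one_mul, norm_pow, norm_pow,
      Real.norm_of_nonneg h1.1.le, Real.norm_of_nonneg h2.1.le]
    calc β₂ ^ negCount s k * β₁ ^ (k + 1 - negCount s k)
        ≤ max β₁ β₂ ^ negCount s k * max β₁ β₂ ^ (k + 1 - negCount s k) := by
          have := h1.1.le
          have := h2.1.le
          gcongr
          · exact le_max_right _ _
          · exact le_max_left _ _
      _ = max β₁ β₂ ^ (k + 1) := by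
          rw [← pow_add, Nat.add_sub_cancel' (negCount_le s k)]

lemma summable_dyadicCoding (s : FullShift) :
    Summable fun k : ℕ => ((s (-((k : ℤ) + 1)) : ℤ) : ℝ) * (1 / 2 : ℝ) ^ (k + 1) := by
  refine Summable.of_norm_bounded (g := fun k : ℕ => (1 / 2 : ℝ) ^ (k + 1)) ?_ fun k => ?_
  · exact (summable_nat_add_iff 1).2 (summable_geometric_of_lt_one (by norm_num) (by norm_num))
  · rw [norm_mul, Real.norm_eq_abs, abs_alphabet, one_mul, Real.norm_of_nonneg (by positivity)]

lemma measurable_negCount (k : ℕ) : Measurable fun s : OneSidedShift => negCount s k := by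
  have : (fun s : OneSidedShift => negCount s k) =
      fun s => ∑ i ∈ Finset.range (k + 1), if (s i : ℤ) = -1 then 1 else 0 := by
    ext s
    rw [negCount, Finset.card_filter]
  rw [this]
  refine Finset.measurable_sum _ fun i _ => ?_
  exact (measurable_of_countable fun a : Alphabet => if (a : ℤ) = -1 then 1 else 0).comp
    (measurable_pi_apply i)

/-- The coding map is measurable, so that the push-forward below is the genuine one. -/
theorem measurable_codingMap {β₁ β₂ : ℝ} (h1 : β₁ ∈ Set.Ioo (0 : ℝ) 1)
    (h2 : β₂ ∈ Set.Ioo (0 : ℝ) 1) : Measurable (codingMap β₁ β₂) := by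
  have hsym : Measurable fun a : Alphabet => ((a : ℤ) : ℝ) := measurable_of_countable _
  have hpi : Measurable (piStar β₁ β₂) := by
    refine measurable_of_tendsto_metrizable
      (f := fun n s => ∑ k ∈ Finset.range n,
        ((s k : ℤ) : ℝ) * β₂ ^ negCount s k * β₁ ^ (k + 1 - negCount s k)) (fun n => ?_)
      (tendsto_pi_nhds.2 fun s => (summable_piStar h1 h2 s).hasSum.tendsto_sum_nat)
    refine Finset.measurable_sum _ fun k _ => ?_
    have e1 : Measurable fun m : ℕ => β₂ ^ m := measurable_from_nat
    have e2 : Measurable fun m : ℕ => β₁ ^ (k + 1 - m) := measurable_from_nat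
    have e3 : Measurable fun s : OneSidedShift => ((s k : ℤ) : ℝ) :=
      hsym.comp (measurable_pi_apply k)
    have e4 : Measurable fun s : OneSidedShift => β₂ ^ negCount s k :=
      e1.comp (measurable_negCount k)
    have e5 : Measurable fun s : OneSidedShift => β₁ ^ (k + 1 - negCount s k) :=
      e2.comp (measurable_negCount k)
    exact (e3.mul e4).mul e5
  have hlim : ∀ s : FullShift, Tendsto (fun n => ∑ k ∈ Finset.range n,
      ((s (-((k : ℤ) + 1)) : ℤ) : ℝ) * (1 / 2 : ℝ) ^ (k + 1)) atTop (nhds (dyadicCoding s)) :=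
    fun s => (summable_dyadicCoding s).hasSum.tendsto_sum_nat
  have hdy : Measurable dyadicCoding := by
    refine measurable_of_tendsto_metrizable (fun n => ?_) (tendsto_pi_nhds.2 hlim)
    refine Finset.measurable_sum _ fun k _ => ?_
    have e : Measurable fun s : FullShift => ((s (-((k : ℤ) + 1)) : ℤ) : ℝ) :=
      hsym.comp (measurable_pi_apply _)
    exact e.mul_const _
  have haff : Measurable (affineScale β₁ β₂) := by
    unfold affineScale
    fun_prop
  have hres : Measurable fun (s : FullShift) (k : ℕ) => s (k : ℤ) :=
    measurable_pi_lambda _ fun k => measurable_pi_apply _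
  exact (haff.comp (hpi.comp hres)).prodMk hdy
/-- The projected measure `μ ∘ π̄⁻¹`. -/
def projectedMeasure (β₁ β₂ : ℝ) (μ : Measure FullShift) : Measure (ℝ × ℝ) :=
  μ.map (codingMap β₁ β₂)

end

end Baker

/-! The first coordinate of the coding can cost at most one dimension, so it is replaced by the
whole line. It then suffices, for each `s` above `h(μ) / log 2`, to find a Borel set `A` that
carries the law of `dyadicCoding` and for which `ℝ × A` has dimension at most `s + 1`.

The set `A` consists of the points that are covered infinitely often by the `N`-th of a sequence of
finite families of balls, so good covers are needed only along infinitely many `N`, depending on the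
point. This makes a weak form of the Shannon–McMillan–Breiman theorem enough. Fix `m` such that the
entropy of `m`-blocks is below `s * m * log 2`. By ergodicity and Fatou's lemma, the averages of the
information of `m`-blocks along the orbit are infinitely often close to their mean or below it
(`frequently_sum_iterate_lt`). By pigeonhole, one of the `m` phases cuts the orbit into `N` blocks
whose total information is less than `c * N`, and at most `exp (c * N)` sequences of blocks have
this property (`card_filter_sum_neg_log_lt_le`). Up to a factor independent of `N`, these count the
balls of radius `2 * 2 ^ (-(N + 1) * m)` that are needed.

Since `dyadicCoding` reads the past, the argument is applied to the inverse shift; by stationarity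
its block entropies are those of the shift. -/

namespace Baker

open Topology NNReal Measure

/-! ### Covers and Hausdorff dimension -/

/-- The product of the line with the upper limit of finite unions of balls of radii
`2 * 2 ^ (-ℓ N)` has dimension at most `s + 1`
if the `s`-dimensional sums of these covers are summable. -/
lemma dimH_univ_prod_limsup_le (C : ℕ → Finset ℝ) {ℓ : ℕ → ℕ} (hℓ : StrictMono ℓ) (s : ℝ≥0)
    (hs : Summable fun N => ((C N).card : ℝ) * ((2 : ℝ) ^ (-(s : ℝ))) ^ ℓ N) :
    dimH ((Set.univ : Set ℝ) ×ˢ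
      {a : ℝ | ∃ᶠ N in atTop, ∃ p ∈ C N, |a - p| ≤ 2 * (1 / 2 : ℝ) ^ ℓ N}) ≤ (s : ℝ≥0∞) + 1 := by
  set A := {a : ℝ | ∃ᶠ N in atTop, ∃ p ∈ C N, |a - p| ≤ 2 * (1 / 2 : ℝ) ^ ℓ N}
  have hU : (Set.univ : Set ℝ) ×ˢ A = ⋃ q : ℤ, Set.Icc (q : ℝ) (q + 1) ×ˢ A := by
    have : (⋃ q : ℤ, Set.Icc (q : ℝ) (q + 1)) = Set.univ := Set.eq_univ_of_forall fun x =>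
      Set.mem_iUnion.2 ⟨⌊x⌋, Int.floor_le x, (Int.lt_floor_add_one x).le⟩
    rw [← Set.iUnion_prod_const, this]
  rw [hU, dimH_iUnion]
  refine iSup_le fun q => ?_
  rw [show (s : ℝ≥0∞) + 1 = ((s + 1 : ℝ≥0) : ℝ≥0∞) by push_cast; rfl]
  refine dimH_le_of_hausdorffMeasure_ne_top (ne_top_of_le_ne_top ENNReal.zero_ne_top ?_)
  let r : ℕ → ℝ := fun N => (1 / 2 : ℝ) ^ ℓ N
  have hr0 : ∀ N, 0 < r N := fun N => by positivity
  let R : ℕ → ℝ≥0∞ := fun N => ENNReal.ofReal (4 * r N)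
  have hr : Tendsto r atTop (𝓝 0) :=
    (_root_.tendsto_pow_atTop_nhds_zero_of_lt_one (by norm_num) (by norm_num)).comp hℓ.tendsto_atTop
  have hR : Tendsto R atTop (𝓝 0) := by
    rw [← ENNReal.ofReal_zero, ← mul_zero (4 : ℝ)]
    exact ENNReal.tendsto_ofReal (hr.const_mul 4)
  have hRanti : Antitone R := fun a b hab => by
    refine ENNReal.ofReal_le_ofReal ?_
    exact mul_le_mul_of_nonneg_left
      (pow_le_pow_of_le_one (by norm_num) (by norm_num) (hℓ.monotone hab)) (by norm_num)
  -- For every `N = n + k`, the strip over each ball is cut into `2 ^ ℓ N` boxes of width `r N`. In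
  -- the maximum metric the ball dominates, which gives diameter at most `4 * r N`.
  let t : ∀ n : ℕ, (Σ k : ℕ, (C (n + k)) × Fin (2 ^ ℓ (n + k))) → Set (ℝ × ℝ) := fun n z =>
    Set.Icc (q + (z.2.2 : ℕ) * r (n + z.1)) (q + ((z.2.2 : ℕ) + 1) * r (n + z.1)) ×ˢ
      Metric.closedBall (z.2.1 : ℝ) (2 * r (n + z.1))
  have hdiam : ∀ n z, Metric.ediam (t n z) ≤ R (n + z.1) := by
    intro n z
    refine Metric.ediam_le fun x hx y hy => ?_
    rw [Prod.edist_eq, max_le_iff]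
    have h0 := hr0 (n + z.1)
    constructor
    · rw [edist_dist, Real.dist_eq]
      refine ENNReal.ofReal_le_ofReal ?_
      have h1 := hx.1
      have h2 := hy.1
      rw [Set.mem_Icc] at h1 h2
      rw [abs_le]
      constructor <;> linarith
    · rw [edist_dist]
      refine ENNReal.ofReal_le_ofReal ?_
      have h1 := hx.2
      have h2 := hy.2
      rw [Metric.mem_closedBall] at h1 h2
      have := dist_triangle_right x.2 y.2 (z.2.1 : ℝ)
      linarith
  have key := hausdorffMeasure_le_liminf_tsum ((s + 1 : ℝ≥0) : ℝ)
    (Set.Icc (q : ℝ) (q + 1) ×ˢ A) (l := atTop) R hR t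
    (Eventually.of_forall fun n z => (hdiam n z).trans (hRanti (Nat.le_add_right _ _)))
    (Eventually.of_forall fun n => ?_)
  · refine key.trans ?_
    -- The extra `1` in the exponent pays for the `2 ^ ℓ N` boxes per ball. What remains is the tail
    -- of the summable series, so the measure is even zero.
    let g : ℕ → ℝ≥0∞ := fun N => ENNReal.ofReal
      ((4 : ℝ) ^ ((s : ℝ) + 1) * (((C N).card : ℝ) * ((2 : ℝ) ^ (-(s : ℝ))) ^ ℓ N))
    have hg : Tendsto (fun i => ∑' k, g (k + i)) atTop (𝓝 0) :=
      ENNReal.tendsto_sum_nat_add g (hs.mul_left _).tsum_ofReal_ne_top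
    refine le_of_le_of_eq (liminf_le_liminf (Eventually.of_forall fun n => ?_)) hg.liminf_eq
    rw [ENNReal.tsum_sigma']
    refine ENNReal.tsum_le_tsum fun k => ?_
    calc ∑' z : (C (n + k)) × Fin (2 ^ ℓ (n + k)), Metric.ediam (t n ⟨k, z⟩) ^ ((s + 1 : ℝ≥0) : ℝ)
        ≤ ∑' z : (C (n + k)) × Fin (2 ^ ℓ (n + k)), R (n + k) ^ ((s + 1 : ℝ≥0) : ℝ) :=
          ENNReal.tsum_le_tsum fun z => ENNReal.rpow_le_rpow (hdiam n ⟨k, z⟩) (by positivity)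
      _ = ((C (n + k)).card * 2 ^ ℓ (n + k) : ℕ) * R (n + k) ^ ((s + 1 : ℝ≥0) : ℝ) := by
          rw [tsum_fintype, Finset.sum_const, Finset.card_univ, Fintype.card_prod, Fintype.card_coe,
            Fintype.card_fin, nsmul_eq_mul]
      _ = g (k + n) := by
          rw [add_comm k n]
          simp only [g, R, r]
          generalize n + k = N
          rw [ENNReal.ofReal_rpow_of_pos (by positivity), ← ENNReal.ofReal_natCast,
            ← ENNReal.ofReal_mul (by positivity)]
          congr 1
          push_cast
          rw [Real.mul_rpow (by norm_num) (by positivity), Real.rpow_add (by positivity : (0 : ℝ) <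
            (1 / 2) ^ ℓ N), Real.rpow_one, ← Real.rpow_natCast (1 / 2) (ℓ N), ← Real.rpow_mul
            (by norm_num), ← Real.rpow_natCast ((2 : ℝ) ^ (-(s : ℝ))), ← Real.rpow_mul
            (by norm_num), one_div, Real.inv_rpow (by norm_num), Real.inv_rpow (by norm_num),
            ← Real.rpow_neg (by norm_num), ← Real.rpow_natCast 2 (ℓ N),
            ← Real.rpow_neg (by norm_num), Real.rpow_neg (by norm_num) ((ℓ N : ℕ) : ℝ)]
          have h2 : (2 : ℝ) ^ ((ℓ N : ℕ) : ℝ) ≠ 0 := by positivity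
          field_simp
  · rintro ⟨x, a⟩ ⟨hx, ha⟩
    obtain ⟨N, hN, p, hp, hap⟩ := (frequently_atTop.1 ha) n
    obtain ⟨k, rfl⟩ := Nat.exists_eq_add_of_le hN
    have hpos := hr0 (n + k)
    have hinv : (2 ^ ℓ (n + k) : ℕ) * r (n + k) = 1 := by
      simp only [r]
      push_cast
      rw [← mul_pow]
      norm_num
    simp only at hx
    rw [Set.mem_Icc] at hx
    obtain ⟨i, hi, h1, h2⟩ : ∃ i : ℕ, i < 2 ^ ℓ (n + k) ∧ (i : ℝ) * r (n + k) ≤ x - q ∧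
        x - q ≤ ((i : ℝ) + 1) * r (n + k) := by
      rcases hx.2.lt_or_eq with hlt | heq
      · have hnn : 0 ≤ (x - q) / r (n + k) := div_nonneg (by linarith) hpos.le
        refine ⟨⌊(x - q) / r (n + k)⌋₊, ?_, ?_, ?_⟩
        · rw [Nat.floor_lt hnn, div_lt_iff₀ hpos, hinv]
          linarith
        · exact (le_div_iff₀ hpos).1 (Nat.floor_le hnn)
        · exact (div_le_iff₀ hpos).1 (Nat.lt_floor_add_one _).le
      -- At the right end `x = q + 1` the floor would be one too large; the last box contains it.
      · refine ⟨2 ^ ℓ (n + k) - 1, Nat.sub_lt (by positivity) one_pos, ?_⟩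
        have : ((2 ^ ℓ (n + k) - 1 : ℕ) : ℝ) = (2 ^ ℓ (n + k) : ℕ) - 1 := by
          rw [Nat.cast_sub Nat.one_le_two_pow]
          simp
        rw [this, sub_add_cancel, sub_mul, hinv, heq]
        constructor <;> linarith
    refine Set.mem_iUnion.2 ⟨⟨k, ⟨p, hp⟩, ⟨i, hi⟩⟩, ⟨?_, ?_⟩, ?_⟩
    · simp only
      linarith
    · simp only
      linarith
    · exact hap

/-- The limsup set in `dimH_univ_prod_limsup_le` is measurable. -/
lemma measurableSet_limsup_balls (C : ℕ → Finset ℝ) (ρ : ℕ → ℝ) :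
    MeasurableSet {a : ℝ | ∃ᶠ N in atTop, ∃ p ∈ C N, |a - p| ≤ ρ N} := by
  refine measurableSet_setOfPred.2 ?_
  simp only [frequently_atTop]
  refine Measurable.forall fun n => Measurable.exists fun N => ?_
  refine measurable_const.and (measurableSet_setOfPred.1 ?_)
  have : {a : ℝ | ∃ p ∈ C N, |a - p| ≤ ρ N} = ⋃ p ∈ C N, Metric.closedBall p (ρ N) := by
    ext a
    simp [Real.dist_eq]
  rw [this]
  exact Finset.measurableSet_biUnion _ fun p _ => measurableSet_closedBall

/-! ### Birkhoff averages, word counting and entropy -/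

/-- For an ergodic map, the Birkhoff averages of a bounded nonnegative function lie infinitely
often below any number larger than its integral. -/
lemma frequently_sum_iterate_lt {X : Type*} [MeasurableSpace X] {μ : Measure X}
    [IsProbabilityMeasure μ] {T : X → X} (hT : Ergodic T μ) {f : X → ℝ} (hf : Measurable f)
    {M : ℝ} (hf0 : ∀ x, 0 ≤ f x) (hfM : ∀ x, f x ≤ M) {c : ℝ} (hc : ∫ x, f x ∂μ < c)
    {m : ℕ} (hm : 0 < m) :
    ∀ᵐ x ∂μ, ∃ᶠ N in atTop, ∑ i ∈ Finset.range (N * m), f (T^[i] x) < c * (N * m : ℕ) := by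
  obtain ⟨d, hd, hdc⟩ := exists_between hc
  have hTm : Measurable T := hT.toMeasurePreserving.measurable
  let S : ℕ → X → ℝ := fun N x => ∑ i ∈ Finset.range (N * m), f (T^[i] x)
  have hS : ∀ N, Measurable (S N) := fun N =>
    Finset.measurable_sum _ fun i _ => hf.comp (hTm.iterate i)
  -- Replacing `x` by `T x` changes the sum by at most a bounded amount. The free constant `K`
  -- absorbs it, so `E` is contained in `T ⁻¹' E` and is null or conull. The gap between `d` and `c`
  -- later absorbs `K`.
  let E : Set X := {x | ∃ K : ℕ, ∃ᶠ N in atTop, S N x < d * (N * m : ℕ) + K}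
  have hE : MeasurableSet E := by
    refine measurableSet_setOfPred.2 ?_
    simp only [frequently_atTop]
    refine Measurable.exists fun K => Measurable.forall fun n => Measurable.exists fun N => ?_
    refine measurable_const.and (measurableSet_setOfPred.1 ?_)
    exact measurableSet_lt (hS N) measurable_const
  have hsub : E ⊆ T ⁻¹' E := by
    rintro x ⟨K, hK⟩
    refine ⟨K + ⌈M⌉₊, hK.mono fun N hN => ?_⟩
    have e : S N (T x) + f x = S N x + f (T^[N * m] x) := by
      simp only [S]
      rw [← Finset.sum_range_succ, Finset.sum_range_succ']
      simp
    have h1 := hf0 x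
    have h2 := hfM (T^[N * m] x)
    have h3 := Nat.le_ceil M
    push_cast
    push_cast at hN
    linarith
  rcases hT.ae_empty_or_univ_of_ae_le_preimage hE.nullMeasurableSet
    (Eventually.of_forall hsub) with h | h
  · exfalso
    -- If `E` is null, the averages are eventually at least `d` almost everywhere, and Fatou's lemma
    -- gives `d ≤ ∫ f`, a contradiction.
    have hae : ∀ᵐ x ∂μ, ENNReal.ofReal d ≤
        liminf (fun N => ENNReal.ofReal (S N x / (N * m : ℕ))) atTop := by
      filter_upwards [h] with x hx
      have hx' : x ∉ E := by
        intro hxE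
        have : (x ∈ E) = (x ∈ (∅ : Set X)) := hx
        rw [this] at hxE
        exact hxE
      have hev : ∀ᶠ N in atTop, ¬ S N x < d * (N * m : ℕ) + (0 : ℕ) := by
        by_contra hcon
        exact hx' ⟨0, hcon⟩
      refine le_liminf_of_le (by isBoundedDefault) ?_
      filter_upwards [hev, eventually_gt_atTop 0] with N hN hN0
      refine ENNReal.ofReal_le_ofReal ?_
      have : (0 : ℝ) < (N * m : ℕ) := by exact_mod_cast Nat.mul_pos hN0 hm
      rw [le_div_iff₀ this]
      simpa using hN
    have hint : Integrable f μ := by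
      refine Integrable.of_bound hf.aestronglyMeasurable M (Eventually.of_forall fun x => ?_)
      rw [Real.norm_of_nonneg (hf0 x)]
      exact hfM x
    have hi : ∀ i, Integrable (fun x => f (T^[i] x)) μ := fun i =>
      (hT.toMeasurePreserving.iterate i).integrable_comp_of_integrable hint
    have hii : ∀ i, ∫ x, f (T^[i] x) ∂μ = ∫ x, f x ∂μ := fun i => by
      have := (hT.toMeasurePreserving.iterate i)
      conv_rhs => rw [← this.map_eq]
      rw [integral_map this.measurable.aemeasurable hf.aestronglyMeasurable]
    have hlint : ∀ᶠ N in atTop, ∫⁻ x, ENNReal.ofReal (S N x / (N * m : ℕ)) ∂μ =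
        ENNReal.ofReal (∫ x, f x ∂μ) := by
      filter_upwards [eventually_gt_atTop 0] with N hN0
      have hpos : (0 : ℝ) < (N * m : ℕ) := by exact_mod_cast Nat.mul_pos hN0 hm
      rw [← ofReal_integral_eq_lintegral_ofReal]
      · congr 1
        rw [integral_div, integral_finsetSum _ fun i _ => hi i]
        simp only [hii, Finset.sum_const, Finset.card_range, nsmul_eq_mul]
        field_simp
      · exact (integrable_finsetSum _ fun i _ => hi i).div_const _
      · exact Eventually.of_forall fun x =>
          div_nonneg (Finset.sum_nonneg fun i _ => hf0 _) hpos.le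
    have h1 : ENNReal.ofReal d ≤ ENNReal.ofReal (∫ x, f x ∂μ) := by
      calc ENNReal.ofReal d = ∫⁻ _, ENNReal.ofReal d ∂μ := by simp
        _ ≤ ∫⁻ x, liminf (fun N => ENNReal.ofReal (S N x / (N * m : ℕ))) atTop ∂μ :=
            lintegral_mono_ae hae
        _ ≤ liminf (fun N => ∫⁻ x, ENNReal.ofReal (S N x / (N * m : ℕ)) ∂μ) atTop :=
            lintegral_liminf_le fun N => ((hS N).div_const _).ennreal_ofReal
        _ = ENNReal.ofReal (∫ x, f x ∂μ) := by
            rw [liminf_congr hlint, liminf_const]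
    rw [ENNReal.ofReal_le_ofReal_iff (integral_nonneg hf0)] at h1
    linarith
  · filter_upwards [h] with x hx
    have hxE : x ∈ E := by
      have : (x ∈ E) = (x ∈ (Set.univ : Set X)) := hx
      rw [this]
      trivial
    obtain ⟨K, hK⟩ := hxE
    have hev : ∀ᶠ N : ℕ in atTop, (K : ℝ) / (c - d) ≤ N :=
      tendsto_natCast_atTop_atTop.eventually (eventually_ge_atTop _)
    refine (hK.and_eventually hev).mono fun N hN => hN.1.trans_le ?_
    have h1 : (K : ℝ) ≤ N * (c - d) := (div_le_iff₀ (by linarith)).1 hN.2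
    have h2 : (N : ℝ) ≤ (N * m : ℕ) := by exact_mod_cast Nat.le_mul_of_pos_right N hm
    nlinarith

/-- The number of words of length `N` whose weight under the product of a probability vector
exceeds `exp (-c)` is at most `exp c`. -/
lemma card_filter_sum_neg_log_lt_le {B : Type*} [Fintype B] (p : B → ℝ) (hp0 : ∀ b, 0 ≤ p b)
    (hp1 : ∑ b, p b = 1) (N : ℕ) (c : ℝ) (G : Finset (Fin N → B))
    (hG : ∀ b ∈ G, (∀ k, 0 < p (b k)) ∧ ∑ k, -Real.log (p (b k)) < c) :
    (G.card : ℝ) ≤ Real.exp c := by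
  have h1 : (G.card : ℝ) * Real.exp (-c) ≤ 1 := by
    calc (G.card : ℝ) * Real.exp (-c) = ∑ _b ∈ G, Real.exp (-c) := by
          rw [Finset.sum_const, nsmul_eq_mul]
      _ ≤ ∑ b ∈ G, ∏ k, p (b k) := by
          refine Finset.sum_le_sum fun b hb => ?_
          obtain ⟨hpos, hlt⟩ := hG b hb
          rw [← Real.exp_log (Finset.prod_pos fun k _ => hpos k),
            Real.log_prod fun k _ => (hpos k).ne']
          rw [Finset.sum_neg_distrib] at hlt
          exact Real.exp_le_exp.2 (by linarith)
      _ ≤ ∑ b : Fin N → B, ∏ k, p (b k) :=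
          Finset.sum_le_sum_of_subset_of_nonneg (Finset.subset_univ _)
            fun b _ _ => Finset.prod_nonneg fun k _ => hp0 _
      _ = 1 := by rw [← Fintype.sum_pow, hp1, one_pow]
  rwa [Real.exp_neg, ← div_eq_mul_inv, div_le_one (Real.exp_pos c)] at h1

/-- Points are determined, up to position `(N + 1) * m`, by the phase `j`, the `N` consecutive
blocks of length `m` that start at `j`, and the remaining `m` letters. -/
lemma agree_of_blocks_eq {ι : Type*} {m N : ℕ} (hm : 0 < m) (j : ℕ) (hj : j < m)
    {a a' : ℕ → ι}
    (hr : ∀ i < m, a (if i < j then i else i + N * m) = a' (if i < j then i else i + N * m))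
    (hb : ∀ k < N, ∀ i < m, a (i + (j + k * m)) = a' (i + (j + k * m))) :
    ∀ i < (N + 1) * m, a i = a' i := by
  intro i hi
  rcases lt_or_ge i j with h | h
  · simpa [h] using hr i (h.trans hj)
  rcases lt_or_ge i (j + N * m) with h2 | h2
  · have e : (i - j) % m + (j + (i - j) / m * m) = i := by
      have := Nat.mod_add_div' (i - j) m
      omega
    have := hb ((i - j) / m) ((Nat.div_lt_iff_lt_mul hm).2 (by omega)) ((i - j) % m)
      (Nat.mod_lt _ hm)
    rwa [e] at this
  · have h3 : i - N * m < m := by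
      rw [add_mul] at hi
      omega
    have := hr (i - N * m) h3
    rwa [if_neg (by omega), Nat.sub_add_cancel (by omega)] at this

lemma measurable_itinerary {X : Type*} [MeasurableSpace X] {ι : Type*} [MeasurableSpace ι]
    {T : X → X} (hT : Measurable T) {P : X → ι} (hP : Measurable P) (n : ℕ) :
    Measurable (itinerary T P n) :=
  measurable_pi_lambda _ fun i => hP.comp (hT.iterate i)

/-- The mean of the information function of a finite partition is its entropy. -/
lemma integral_neg_log_measureReal {X : Type*} [MeasurableSpace X] (μ : Measure X)
    [IsProbabilityMeasure μ] {B : Type*} [Fintype B] [MeasurableSpace B]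
    [MeasurableSingletonClass B] {Q : X → B} (hQ : Measurable Q) :
    ∫ x, -Real.log (μ.real (Q ⁻¹' {Q x})) ∂μ = partitionEntropy μ Q := by
  have : IsProbabilityMeasure (μ.map Q) := Measure.isProbabilityMeasure_map hQ.aemeasurable
  have h := integral_map hQ.aemeasurable (μ := μ)
    (f := fun b => -Real.log (μ.real (Q ⁻¹' {b})))
    (measurable_of_finite _).aestronglyMeasurable
  rw [← h, integral_fintype Integrable.of_finite, partitionEntropy]
  refine Finset.sum_congr rfl fun b _ => ?_
  rw [map_measureReal_apply hQ (measurableSet_singleton b), Real.negMulLog, smul_eq_mul]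
  ring

/-! ### From block entropy to dimension -/

/-- If the entropy of the `m`-th join is less than `s * m * log 2`, then the distribution of a
dyadic coding of the itineraries lives on a set whose product with a line has dimension at most
`s + 1`. -/
theorem exists_measurableSet_dimH_univ_prod_le {X : Type*} [MeasurableSpace X] {μ : Measure X}
    [IsProbabilityMeasure μ] {T : X → X} (hT : Ergodic T μ) {ι : Type*} [Fintype ι]
    [MeasurableSpace ι] [MeasurableSingletonClass ι] {P : X → ι} (hP : Measurable P)
    {φ : X → ℝ} (hφ : ∀ x y L, (∀ i < L, P (T^[i] x) = P (T^[i] y)) →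
      |φ x - φ y| ≤ 2 * (1 / 2 : ℝ) ^ L)
    {m : ℕ} (hm : 0 < m) {s : ℝ≥0}
    (hs : partitionEntropy μ (itinerary T P m) < s * m * Real.log 2) :
    ∃ A : Set ℝ, MeasurableSet A ∧ (∀ᵐ x ∂μ, φ x ∈ A) ∧
      dimH ((Set.univ : Set ℝ) ×ˢ A) ≤ (s : ℝ≥0∞) + 1 := by
  classical
  obtain ⟨c, hHc, hcs⟩ := exists_between hs
  have hTm : Measurable T := hT.toMeasurePreserving.measurable
  let Q : X → (Fin m → ι) := itinerary T P m
  have hQ : Measurable Q := measurable_itinerary hTm hP m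
  let p : (Fin m → ι) → ℝ := fun b => μ.real (Q ⁻¹' {b})
  have hp0 : ∀ b, 0 ≤ p b := fun b => measureReal_nonneg
  have hp1 : ∑ b, p b = 1 := by
    have : IsProbabilityMeasure (μ.map Q) := Measure.isProbabilityMeasure_map hQ.aemeasurable
    rw [← probReal_univ (μ := μ.map Q), ← Finset.coe_univ, ← sum_measureReal_singleton]
    exact Finset.sum_congr rfl fun b _ =>
      (map_measureReal_apply hQ (measurableSet_singleton b)).symm
  let G : ∀ N, Finset (Fin N → Fin m → ι) := fun N =>
    Finset.univ.filter fun b => (∀ k, 0 < p (b k)) ∧ ∑ k, -Real.log (p (b k)) < c * N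
  have hG : ∀ N, ((G N).card : ℝ) ≤ Real.exp (c * N) := fun N =>
    card_filter_sum_neg_log_lt_le p hp0 hp1 N _ _ fun b hb => (Finset.mem_filter.1 hb).2
  -- The code records the phase `j`, the `j` letters before the blocks together with the `m - j`
  -- letters after them, and the `N` blocks. It thus fixes the first `(N + 1) * m` labels.
  let code : ∀ N, Fin m → X → Fin m × (Fin m → ι) × (Fin N → Fin m → ι) := fun N j x =>
    (j, fun i => P (T^[if i < j then (i : ℕ) else i + N * m] x), fun k => Q (T^[j + k * m] x))
  -- The centre is the value of `φ` at any point with the given code. The value `0` for codes that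
  -- do not occur is harmless, since only codes of actual points are used.
  let center : ∀ N, Fin m × (Fin m → ι) × (Fin N → Fin m → ι) → ℝ := fun N d =>
    if h : ∃ x, code N d.1 x = d then φ h.choose else 0
  let C : ℕ → Finset ℝ := fun N =>
    ((Finset.univ : Finset (Fin m)) ×ˢ (Finset.univ : Finset (Fin m → ι)) ×ˢ G N).image (center N)
  have hcenter : ∀ N j x, |φ x - center N (code N j x)| ≤ 2 * (1 / 2 : ℝ) ^ ((N + 1) * m) := by
    intro N j x
    have hex : ∃ y, code N (code N j x).1 y = code N j x := ⟨x, rfl⟩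
    simp only [center]
    rw [dif_pos hex]
    have hy : code N j hex.choose = code N j x := hex.choose_spec
    generalize hex.choose = y at hy
    refine hφ _ _ _ ?_
    have h1 := congrArg (fun z => z.2.1) hy
    have h2 := congrArg (fun z => z.2.2) hy
    refine agree_of_blocks_eq hm j j.2 (a := fun i => P (T^[i] x)) (a' := fun i => P (T^[i] y))
      (fun i hi => ?_) fun k hk i hi => ?_
    · exact (congrFun h1 ⟨i, hi⟩).symm
    · have := congrFun (congrFun h2 ⟨k, hk⟩) ⟨i, hi⟩
      simp only [code, Q, itinerary, ← Function.iterate_add_apply] at this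
      exact this.symm
  have hℓ : StrictMono fun N : ℕ => (N + 1) * m := fun a b hab =>
    Nat.mul_lt_mul_of_pos_right (Nat.succ_lt_succ hab) hm
  refine ⟨{a : ℝ | ∃ᶠ N in atTop, ∃ q ∈ C N, |a - q| ≤ 2 * (1 / 2 : ℝ) ^ ((N + 1) * m)},
    measurableSet_limsup_balls C _, ?_, dimH_univ_prod_limsup_le C hℓ s ?_⟩
  · obtain ⟨M, hM⟩ : ∃ M, ∀ b, -Real.log (p b) ≤ M := by
      obtain ⟨M, hM⟩ := (Set.finite_range fun b => -Real.log (p b)).bddAbove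
      exact ⟨M, fun b => hM ⟨b, rfl⟩⟩
    have hf0 : ∀ b, 0 ≤ -Real.log (p b) := fun b =>
      neg_nonneg.2 (Real.log_nonpos (hp0 b) measureReal_le_one)
    have hfreq := frequently_sum_iterate_lt hT (f := fun x => -Real.log (p (Q x)))
      ((measurable_of_finite fun b => -Real.log (p b)).comp hQ) (fun x => hf0 _) (fun x => hM _)
      ((integral_neg_log_measureReal μ hQ).trans_lt hHc) hm
    -- Since `Real.log 0 = 0`, a block of measure zero would count as carrying no information; such
    -- blocks have to be excluded separately.
    have hpos : ∀ᵐ x ∂μ, 0 < p (Q x) := by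
      have hnull : ∀ b, ∀ᵐ x ∂μ, Q x = b → 0 < p b := by
        intro b
        rcases (hp0 b).lt_or_eq with h | h
        · exact Eventually.of_forall fun _ _ => h
        · have h0 : μ (Q ⁻¹' {b}) = 0 := (measureReal_eq_zero_iff).1 h.symm
          filter_upwards [measure_eq_zero_iff_ae_notMem.1 h0] with x hx hxb
          exact absurd hxb hx
      filter_upwards [ae_all_iff.2 hnull] with x hx
      exact hx _ rfl
    have hpos' : ∀ᵐ x ∂μ, ∀ i, 0 < p (Q (T^[i] x)) := ae_all_iff.2 fun i =>
      (hT.toMeasurePreserving.iterate i).quasiMeasurePreserving.ae hpos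
    filter_upwards [hfreq, hpos'] with x hx hxp
    refine hx.mono fun N hN => ?_
    -- The sum over `N * m` times splits into `m` sums, one for each phase, so one of them is less
    -- than `c * N`. This avoids ergodicity of `T^[m]`, which may fail.
    obtain ⟨j, hj⟩ : ∃ j : Fin m, ∑ k : Fin N, -Real.log (p (Q (T^[j + k * m] x))) < c * N := by
      by_contra! hcon
      have h1 := Finset.sum_le_sum fun j (_ : j ∈ (Finset.univ : Finset (Fin m))) => hcon j
      rw [Finset.sum_const, Finset.card_univ, Fintype.card_fin, nsmul_eq_mul] at h1
      have h2 : ∑ i ∈ Finset.range (N * m), -Real.log (p (Q (T^[i] x))) =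
          ∑ j : Fin m, ∑ k : Fin N, -Real.log (p (Q (T^[j + k * m] x))) := by
        rw [Finset.sum_comm, ← Fin.sum_univ_eq_sum_range
          (fun i => -Real.log (p (Q (T^[i] x)))), ← finProdFinEquiv.sum_comp,
          Fintype.sum_prod_type]
        refine Finset.sum_congr rfl fun k _ => Finset.sum_congr rfl fun j _ => ?_
        simp [finProdFinEquiv, mul_comm]
      rw [h2] at hN
      push_cast at hN
      nlinarith
    refine ⟨center N (code N j x), Finset.mem_image_of_mem _ ?_, hcenter N j x⟩
    simp only [Finset.mem_product, Finset.mem_univ, true_and]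
    exact Finset.mem_filter.2 ⟨Finset.mem_univ _, fun k => hxp _, hj⟩
  -- Passing from `N` to `N + 1` multiplies the bound on the number of balls by `exp c` and the
  -- weight of each by `2 ^ (-s * m)`. The product is below `1` because `c < s * m * log 2`.
  · let ρ : ℝ := Real.exp c * ((2 : ℝ) ^ (-(s : ℝ))) ^ m
    have hρ0 : 0 ≤ ρ := by positivity
    have hρ1 : ρ < 1 := by
      have : ρ = Real.exp (c - s * m * Real.log 2) := by
        simp only [ρ]
        rw [Real.rpow_def_of_pos (by norm_num), ← Real.exp_nat_mul, ← Real.exp_add]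
        congr 1
        ring
      rw [this, Real.exp_lt_one_iff]
      linarith
    refine Summable.of_nonneg_of_le (fun N => by positivity) (fun N => ?_)
      ((summable_geometric_of_lt_one hρ0 hρ1).mul_left
        ((m : ℝ) * (Fintype.card (Fin m → ι)) * ((2 : ℝ) ^ (-(s : ℝ))) ^ m))
    have h1 : ((C N).card : ℝ) ≤ m * Fintype.card (Fin m → ι) * Real.exp (c * N) := by
      calc ((C N).card : ℝ)
          ≤ ((m * (Fintype.card (Fin m → ι) * (G N).card) : ℕ) : ℝ) := by
            refine Nat.cast_le.2 (Finset.card_image_le.trans_eq ?_)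
            rw [Finset.card_product, Finset.card_product, Finset.card_univ, Finset.card_univ,
              Fintype.card_fin]
        _ ≤ m * Fintype.card (Fin m → ι) * Real.exp (c * N) := by
            rw [Nat.cast_mul, Nat.cast_mul, ← mul_assoc]
            exact mul_le_mul_of_nonneg_left (hG N) (by positivity)
    calc ((C N).card : ℝ) * ((2 : ℝ) ^ (-(s : ℝ))) ^ ((N + 1) * m)
        ≤ (m * Fintype.card (Fin m → ι) * Real.exp (c * N)) *
          ((2 : ℝ) ^ (-(s : ℝ))) ^ ((N + 1) * m) :=
          mul_le_mul_of_nonneg_right h1 (by positivity)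
      _ = _ := by
          simp only [ρ]
          rw [mul_pow, mul_comm c, Real.exp_nat_mul, add_mul, one_mul, pow_add, mul_comm N m,
            pow_mul _ m N]
          ring

/-! ### The dyadic coding and time reversal -/

/-- Sequences with the same past up to time `-L` have dyadic codings that are `2 * 2 ^ (-L)`
close. -/
lemma abs_dyadicCoding_sub_le {x y : FullShift} {L : ℕ}
    (h : ∀ i < L, x (-((i : ℤ) + 1)) = y (-((i : ℤ) + 1))) :
    |dyadicCoding x - dyadicCoding y| ≤ 2 * (1 / 2 : ℝ) ^ L := by
  have hsum := (summable_dyadicCoding x).sub (summable_dyadicCoding y)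
  rw [dyadicCoding, dyadicCoding, ← (summable_dyadicCoding x).tsum_sub (summable_dyadicCoding y),
    ← hsum.sum_add_tsum_nat_add L, Finset.sum_eq_zero fun i hi => by
      rw [h i (Finset.mem_range.1 hi), sub_self], zero_add, ← Real.norm_eq_abs]
  -- The first `L` terms cancel; the `i`-th term of the tail is at most `2 * 2 ^ (-(L + i + 1)) = 2
  -- ^ (-L) * 2 ^ (-i)`.
  have hg : HasSum (fun i : ℕ => (1 / 2 : ℝ) ^ L * (1 / 2) ^ i) ((1 / 2 : ℝ) ^ L * 2) :=
    hasSum_geometric_two.mul_left _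
  rw [mul_comm]
  refine tsum_of_norm_bounded hg fun i => ?_
  rw [← sub_mul, norm_mul, Real.norm_eq_abs, Real.norm_of_nonneg (by positivity), ← pow_add,
    show i + L + 1 = (L + i) + 1 by ring, pow_succ]
  have h2 : |((x (-(((i + L : ℕ) : ℤ) + 1)) : ℤ) : ℝ) - ((y (-(((i + L : ℕ) : ℤ) + 1)) : ℤ) : ℝ)|
      ≤ 2 := by
    refine (abs_sub _ _).trans ?_
    rw [abs_alphabet, abs_alphabet]
    norm_num
  have h3 : (0 : ℝ) < (1 / 2) ^ (L + i) := by positivity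
  nlinarith

/-- The shift as a measurable equivalence. -/
def shiftEquiv : FullShift ≃ᵐ FullShift where
  toFun := shift
  invFun s k := s (k - 1)
  left_inv s := by
    ext k
    simp [shift]
  right_inv s := by
    ext k
    simp [shift]
  measurable_toFun := measurable_pi_lambda _ fun k => measurable_pi_apply _
  measurable_invFun := measurable_pi_lambda _ fun k => measurable_pi_apply _

lemma iterate_shift_apply (n : ℕ) (s : FullShift) (k : ℤ) : shift^[n] s k = s (k + n) := by
  induction n generalizing s with
  | zero => simp
  | succ n ih =>
    rw [Function.iterate_succ_apply, ih, shift]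
    congr 1
    push_cast
    ring

lemma iterate_shiftEquiv_symm_apply (n : ℕ) (s : FullShift) (k : ℤ) :
    shiftEquiv.symm^[n] s k = s (k - n) := by
  induction n generalizing s with
  | zero => simp
  | succ n ih =>
    rw [Function.iterate_succ_apply, ih]
    change s (k - n - 1) = _
    congr 1
    push_cast
    ring

/-- The entropy of a word of length `m` in the past equals that of one in the future. -/
lemma partitionEntropy_itinerary_symm {μ : Measure FullShift} {ι : Type*} [Fintype ι]
    [MeasurableSpace ι] [MeasurableSingletonClass ι] {e : Alphabet → ι} (he : Measurable e)
    (hμ : MeasurePreserving shiftEquiv.symm μ μ) (m : ℕ) :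
    partitionEntropy μ (itinerary shiftEquiv.symm (fun s => e (s (-1))) m) =
      partitionEntropy μ (itinerary shift (fun s => e (s 0)) m) := by
  have hQ : Measurable (itinerary shift (fun s : FullShift => e (s 0)) m) :=
    measurable_itinerary shiftEquiv.measurable (he.comp (measurable_pi_apply 0)) m
  -- The backward itinerary reads the coordinates `-1, …, -m`. Reversing the word is a bijection of
  -- the index set, and `m` steps of the inverse shift carry the positions `0, …, m - 1` to `-m, …,
  -- -1`.
  rw [partitionEntropy, partitionEntropy, ← (Equiv.arrowCongr Fin.revPerm (Equiv.refl ι)).sum_comp]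
  refine Finset.sum_congr rfl fun b _ => ?_
  congr 1
  rw [← (hμ.iterate m).measureReal_preimage (hQ (measurableSet_singleton b)).nullMeasurableSet]
  congr 1
  ext s
  simp only [Set.mem_preimage, Set.mem_singleton_iff, funext_iff]
  rw [← Fin.revPerm.forall_congr_right]
  refine forall_congr' fun i => ?_
  simp only [itinerary, iterate_shift_apply, iterate_shiftEquiv_symm_apply, Fin.revPerm_apply,
    Equiv.arrowCongr_apply, Equiv.coe_refl, Function.comp, Fin.revPerm_symm, Fin.rev_rev, id]
  have : (-1 : ℤ) - (Fin.rev i : ℕ) = 0 + (i : ℕ) - (m : ℕ) := by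
    rw [Fin.val_rev]
    have := i.2
    omega
  rw [this]

end Baker

/-! ### The dimension bound -/

theorem proposition5p1 (β₁ β₂ : ℝ) (hβ₁ : β₁ ∈ Set.Ioo (0 : ℝ) 1) (hβ₂ : β₂ ∈ Set.Ioo (0 : ℝ) 1)
    (hβ : 1 ≤ β₁ + β₂)
    (μ : Measure Baker.FullShift) [IsProbabilityMeasure μ] (hμ : Ergodic Baker.shift μ) :
    Baker.dimHMeasure (Baker.projectedMeasure β₁ β₂ μ) ≤
      Baker.metricEntropy Baker.shift μ / ENNReal.ofReal (Real.log 2) + 1 := by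
  have hlog : 0 < Real.log 2 := Real.log_pos (by norm_num)
  have hlog' : ENNReal.ofReal (Real.log 2) ≠ 0 := (ENNReal.ofReal_pos.2 hlog).ne'
  refine ENNReal.le_of_forall_pos_le_add fun ε hε hfin => ?_
  set h := Baker.metricEntropy Baker.shift μ
  have hfin' : h / ENNReal.ofReal (Real.log 2) ≠ ∞ :=
    ne_top_of_le_ne_top hfin.ne le_self_add
  -- Here `s = h / log 2 + ε`, which is finite and leaves strict room above the entropy.
  obtain ⟨s, hs⟩ : ∃ s : NNReal, (s : ℝ≥0∞) = _ := WithTop.ne_top_iff_exists.1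
    (ENNReal.add_ne_top.2 ⟨hfin', ENNReal.coe_ne_top (r := ε)⟩)
  have hlt : h < ENNReal.ofReal (s * Real.log 2) := by
    have h1 : h / ENNReal.ofReal (Real.log 2) < s := by
      rw [hs]
      exact ENNReal.lt_add_right hfin' (by simpa using hε.ne')
    rw [ENNReal.div_lt_iff (Or.inl hlog') (Or.inl ENNReal.ofReal_ne_top)] at h1
    rwa [ENNReal.ofReal_mul s.coe_nonneg, ENNReal.ofReal_coe_nnreal]
  let e := Fintype.equivFin Baker.Alphabet
  have he : Measurable e := measurable_of_finite _
  have hP : Measurable fun s : Baker.FullShift => e (s 0) := he.comp (measurable_pi_apply 0)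
  have hle : Baker.entropyOfPartition Baker.shift μ (fun s => e (s 0)) ≤ h :=
    le_iSup_of_le _ (le_iSup_of_le _ (le_iSup_of_le hP le_rfl))
  -- A `limsup` below the threshold provides a single block length; `0 < m` is required to clear the
  -- division by `m`.
  obtain ⟨m, hm, hm0⟩ := ((eventually_lt_of_limsup_lt (hle.trans_lt hlt)).and
    (eventually_gt_atTop 0)).exists
  have hsymm : Ergodic Baker.shiftEquiv.symm μ := Ergodic.symm (e := Baker.shiftEquiv) hμ
  have hent : Baker.partitionEntropy μ (Baker.itinerary Baker.shiftEquiv.symm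
      (fun s => e (s (-1))) m) < s * m * Real.log 2 := by
    rw [Baker.partitionEntropy_itinerary_symm he hsymm.toMeasurePreserving]
    have h2 := (ENNReal.ofReal_lt_ofReal_iff'.1 hm).1
    rw [div_lt_iff₀ (by exact_mod_cast hm0)] at h2
    linarith
  have hφ : ∀ (x y : Baker.FullShift) (L : ℕ),
      (∀ i < L, e ((Baker.shiftEquiv.symm^[i] x) (-1)) = e ((Baker.shiftEquiv.symm^[i] y) (-1))) →
        |Baker.dyadicCoding x - Baker.dyadicCoding y| ≤ 2 * (1 / 2 : ℝ) ^ L := by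
    intro x y L hxy
    refine Baker.abs_dyadicCoding_sub_le fun i hi => ?_
    have := e.injective (hxy i hi)
    simpa only [Baker.iterate_shiftEquiv_symm_apply, neg_add_rev, sub_eq_add_neg, add_comm]
      using this
  obtain ⟨A, hA, hmem, hdim⟩ := Baker.exists_measurableSet_dimH_univ_prod_le hsymm
    (he.comp (measurable_pi_apply (-1))) (φ := Baker.dyadicCoding) hφ hm0 hent
  have hcod := Baker.measurable_codingMap hβ₁ hβ₂
  have hB : MeasurableSet ((Set.univ : Set ℝ) ×ˢ A) := MeasurableSet.univ.prod hA
  calc Baker.dimHMeasure (Baker.projectedMeasure β₁ β₂ μ)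
      ≤ dimH ((Set.univ : Set ℝ) ×ˢ A) := by
        refine iInf_le_of_le _ (iInf_le_of_le hB (iInf_le_of_le ?_ le_rfl))
        rw [Baker.projectedMeasure, Measure.map_apply hcod hB, ← mem_ae_iff_prob_eq_one
          (hcod hB)]
        filter_upwards [hmem] with x hx
        exact ⟨Set.mem_univ _, hx⟩
    _ ≤ s + 1 := hdim
    _ = h / ENNReal.ofReal (Real.log 2) + 1 + ε := by rw [hs, add_right_comm]
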